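/- For $x>1$ let $\operatorname{li}(x)=\mathrm{p.v.}\int_0^x \frac{dt}{\log t}$; it maps $(1,\infty)$ increasingly onto $\mathbb R$, and $\operatorname{ali}=\operatorname{li}^{-1}\colon\mathbb R\to(1,\infty)$ denotes its inverse. Let $V=1+\sum_{n\ge1}P_{n-1}(y)x^{-n}$ be the unique formal series in $1/x$, with polynomials $P_{n-1}$ of degree at most $n$, that satisfies $$V=1+\frac yx-\frac1xV-V_x-\frac1xV_y+\frac1x\log V ,$$ and for $N\ge1$ put, for $u=e^x$, $$f_N(e^x)=x e^x\Bigl(1+\sum_{n=1}^N\frac{P_{n-1}(\log x)}{x^n}\Bigr).$$ Define $(a_n)_{n\ge1}$ by the formal identity $\log\bigl(1-\sum_{n\ge1}n!\,x^{-n}\bigr)^{-1}=\sum_{n\ge1}\frac{a_n}{n}x^{-n}$. Let $c_N$ be the least $c>0$ such that $x\bigl(1-\sum_{n=1}^N n!\,x^{-n}\bigr)\ge1$ for all real $x\ge c$. Let $d_N$ be the least $d>0$ such that $$\Bigl|\log\Bigl(1-\sum_{n=1}^N\frac{n!}{x^n}\Bigr)^{-1}-\sum_{n=1}^N\frac{a_n}{n}\frac1{x^n}\Bigr|\le\frac{a_{N+1}}{N+1}\frac1{|x|^{N+1}}$$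 for all complex $x$ with $|x|\ge d$. Let $\beta_N\ge e$ be the solution of $\beta_N/\log\beta_N=\max(e,c_N,d_N)$, and put $x_N=\max\bigl(\beta_N,\tfrac43(N+1),e^2\bigr)$ and $u_N=e^{x_N}$. Theorem. Let $N\ge1$ be an integer. Call a real number $v\ge u_N$ admissible if $$\Bigl|\operatorname{li}(f_N(u))-u\Bigr|\le 13\,(N+1)!\,\frac{u(\log\log u)^N}{(\log u)^{N+1}}\qquad\text{for all }u>v .$$ There is an admissible $v>u_N$. Moreover, if $v_N$ denotes the least admissible number (so that the following holds a fortiori for $u\ge v$, for every admissible $v$), then for every $u\ge v_N$ there is a real $\theta$ with $|\theta|\le1$ such that $$\operatorname{ali}(u)=f_N(u)+26\,\theta\,(N+1)!\,u\Bigl(\frac{\log\log u}{\log u}\Bigr)^N .$$ -/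

import Mathlib

open Filter Topology MeasureTheory
open scoped Nat Polynomial PowerSeries

noncomputable section

namespace AliExpansion

/-! ### The logarithmic integral and its inverse -/

/-- The truncated integral over `(0, 1 - ε) ∪ (1 + ε, x)` of `1 / log t`. -/
def liTrunc (x ε : ℝ) : ℝ :=
  (∫ t in (0 : ℝ)..(1 - ε), 1 / Real.log t) + ∫ t in (1 + ε)..x, 1 / Real.log t

/-- The logarithmic integral `li x`, for `x > 1`: the principal value of `∫ t in 0..x, 1 / log t`. -/
def li (x : ℝ) : ℝ := limUnder (𝓝[>] (0 : ℝ)) (liTrunc x)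

/-- The inverse function `ℝ → (1, ∞)` of `li : (1, ∞) → ℝ`. -/
def ali : ℝ → ℝ := Function.invFunOn li (Set.Ioi 1)

/-! ### The formal expansion

Formal series `∑ qₙ(y) / xⁿ` are power series in the variable `X = 1 / x` with coefficients in the
polynomial ring `ℝ[y]`. -/

/-- The derivative with respect to `x = 1 / X`: `∑ qₙ / xⁿ ↦ - ∑ n qₙ / xⁿ⁺¹`. -/
def derivX (V : ℝ[X]⟦X⟧) : ℝ[X]⟦X⟧ := -(PowerSeries.X ^ 2 * PowerSeries.derivative ℝ[X] V)

/-- The derivative with respect to `y`, coefficient by coefficient. -/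
def derivY (V : ℝ[X]⟦X⟧) : ℝ[X]⟦X⟧ :=
  PowerSeries.mk fun n => Polynomial.derivative (PowerSeries.coeff n V)

/-- The operator `T V = 1 + y/x - V/x - V_x - V_y/x + (log V)/x`. -/
def formalT (V : ℝ[X]⟦X⟧) : ℝ[X]⟦X⟧ :=
  1 + PowerSeries.C Polynomial.X * PowerSeries.X - PowerSeries.X * V - derivX V
    - PowerSeries.X * derivY V + PowerSeries.X * PowerSeries.logOf V

/-- `V = ∑ qₙ(y) / xⁿ`, with `q₀ = 1` and `deg qₙ ≤ n`, solves
`V = 1 + y/x - V/x - V_x - V_y/x + (log V)/x`. -/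
def IsFormalSolution (V : ℝ[X]⟦X⟧) : Prop :=
  (∀ n, (PowerSeries.coeff n V).natDegree ≤ n) ∧ PowerSeries.constantCoeff V = 1 ∧ V = formalT V

theorem coeff_logOf_congr {V W : ℝ[X]⟦X⟧} (hV : PowerSeries.constantCoeff V = 1)
    (hW : PowerSeries.constantCoeff W = 1) {n : ℕ} (h : PowerSeries.X ^ n ∣ V - W) :
    PowerSeries.X ^ n ∣ PowerSeries.logOf V - PowerSeries.logOf W := by
  have sV : PowerSeries.HasSubst (V - 1) := .of_constantCoeff_zero' (by simp [hV])
  have sW : PowerSeries.HasSubst (W - 1) := .of_constantCoeff_zero' (by simp [hW])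
  rw [PowerSeries.X_pow_dvd_iff]
  intro e he
  rw [map_sub, sub_eq_zero, PowerSeries.logOf, PowerSeries.logOf, PowerSeries.coeff_subst' sV,
    PowerSeries.coeff_subst' sW]
  refine finsum_congr fun d => ?_
  have h1 : PowerSeries.X ^ n ∣ (V - 1) ^ d - (W - 1) ^ d :=
    dvd_trans (by simpa using h) (sub_dvd_pow_sub_pow (V - 1) (W - 1) d)
  have h2 := PowerSeries.X_pow_dvd_iff.1 h1 e he
  rw [map_sub, sub_eq_zero] at h2
  rw [h2]

theorem formalT_congr {V W : ℝ[X]⟦X⟧} (hV : PowerSeries.constantCoeff V = 1)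
    (hW : PowerSeries.constantCoeff W = 1) {n : ℕ} (h : PowerSeries.X ^ n ∣ V - W) :
    PowerSeries.X ^ (n + 1) ∣ formalT V - formalT W := by
  have hl := coeff_logOf_congr hV hW h
  have hy : PowerSeries.X ^ n ∣ derivY V - derivY W := by
    rw [PowerSeries.X_pow_dvd_iff] at h ⊢
    intro m hm
    have := h m hm
    rw [map_sub, sub_eq_zero] at this
    simp [derivY, this]
  have hx : PowerSeries.X ^ (n + 1) ∣ derivX V - derivX W := by
    rw [PowerSeries.X_pow_dvd_iff] at h ⊢
    intro m hm
    rcases m with _ | m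
    · simp [derivX]
    rcases m with _ | m
    · simp [derivX, PowerSeries.coeff_X_pow_mul']
    have := h (m + 1) (by omega)
    rw [map_sub, sub_eq_zero] at this
    simp [derivX, PowerSeries.coeff_X_pow_mul', PowerSeries.coeff_derivative, this]
  have e : formalT V - formalT W = PowerSeries.X * ((PowerSeries.logOf V - PowerSeries.logOf W)
      - (V - W) - (derivY V - derivY W)) - (derivX V - derivX W) := by
    simp only [formalT]; ring
  rw [e]
  refine dvd_sub ?_ hx
  rw [pow_succ']
  exact mul_dvd_mul_left _ (dvd_sub (dvd_sub hl h) hy)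

theorem constantCoeff_formalT {V : ℝ[X]⟦X⟧} : PowerSeries.constantCoeff (formalT V) = 1 := by
  simp [formalT, derivX]

theorem natDegree_coeff_pow {U : ℝ[X]⟦X⟧} (h : ∀ n, (PowerSeries.coeff n U).natDegree ≤ n)
    (d n : ℕ) : (PowerSeries.coeff n (U ^ d)).natDegree ≤ n := by
  induction d generalizing n with
  | zero => by_cases hn : n = 0 <;> simp [PowerSeries.coeff_one, hn]
  | succ d ih =>
    rw [pow_succ, PowerSeries.coeff_mul]
    refine Polynomial.natDegree_sum_le_of_forall_le _ _ fun p hp => ?_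
    have := Finset.HasAntidiagonal.mem_antidiagonal.1 hp
    exact (Polynomial.natDegree_mul_le).trans (by have := ih p.1; have := h p.2; omega)

theorem natDegree_coeff_logOf {V : ℝ[X]⟦X⟧} (h : ∀ n, (PowerSeries.coeff n V).natDegree ≤ n)
    (h1 : PowerSeries.constantCoeff V = 1) (n : ℕ) :
    (PowerSeries.coeff n (PowerSeries.logOf V)).natDegree ≤ n := by
  have sV : PowerSeries.HasSubst (V - 1) := .of_constantCoeff_zero' (by simp [h1])
  have hU : ∀ n, (PowerSeries.coeff n (V - 1)).natDegree ≤ n := by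
    intro n
    rw [map_sub]
    refine (Polynomial.natDegree_sub_le _ _).trans (max_le (h n) ?_)
    by_cases hn : n = 0 <;> simp [PowerSeries.coeff_one, hn]
  rw [PowerSeries.logOf, PowerSeries.coeff_subst' sV]
  refine finsum_induction (fun p : ℝ[X] => p.natDegree ≤ n) (by simp)
    (fun p q hp hq => (Polynomial.natDegree_add_le _ _).trans (max_le hp hq)) fun d => ?_
  have hq := natDegree_coeff_pow hU d n
  rw [PowerSeries.coeff_log]
  split_ifs
  · simp
  · rw [smul_eq_mul, ← Algebra.smul_def]
    exact (Polynomial.natDegree_smul_le _ _).trans hq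

theorem natDegree_coeff_formalT {V : ℝ[X]⟦X⟧} (h : ∀ n, (PowerSeries.coeff n V).natDegree ≤ n)
    (h1 : PowerSeries.constantCoeff V = 1) (n : ℕ) :
    (PowerSeries.coeff n (formalT V)).natDegree ≤ n := by
  rcases n with _ | n
  · rw [PowerSeries.coeff_zero_eq_constantCoeff_apply, constantCoeff_formalT]; simp
  have hx : (PowerSeries.coeff (n + 1) (derivX V)).natDegree ≤ n + 1 := by
    rcases n with _ | n
    · simp [derivX, PowerSeries.coeff_X_pow_mul']
    · have : PowerSeries.coeff (n + 1 + 1) (derivX V)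
          = -(PowerSeries.coeff (n + 1) V * (((n : ℕ) + 1 : ℕ) : ℝ[X])) := by
        simp [derivX, PowerSeries.coeff_X_pow_mul', PowerSeries.coeff_derivative]
      rw [this, Polynomial.natDegree_neg]
      refine Polynomial.natDegree_mul_le.trans ?_
      rw [Polynomial.natDegree_natCast]
      have := h (n + 1)
      omega
  have hc : (PowerSeries.coeff (n + 1)
      (PowerSeries.C (Polynomial.X : ℝ[X]) * PowerSeries.X)).natDegree ≤ n + 1 := by
    rw [PowerSeries.coeff_C_mul, PowerSeries.coeff_X]
    split_ifs <;> simp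
  have hy : (PowerSeries.coeff n (derivY V)).natDegree ≤ n + 1 := by
    rw [derivY, PowerSeries.coeff_mk]
    exact (Polynomial.natDegree_derivative_le _).trans (by have := h n; omega)
  have hl := natDegree_coeff_logOf h h1 n
  have hv := h n
  simp only [formalT, map_add, map_sub, PowerSeries.coeff_succ_X_mul]
  refine (Polynomial.natDegree_add_le _ _).trans (max_le ?_ (by omega))
  refine (Polynomial.natDegree_sub_le _ _).trans (max_le ?_ hy)
  refine (Polynomial.natDegree_sub_le _ _).trans (max_le ?_ hx)
  refine (Polynomial.natDegree_sub_le _ _).trans (max_le ?_ (by omega))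
  refine (Polynomial.natDegree_add_le _ _).trans (max_le ?_ hc)
  simp [PowerSeries.coeff_one]

theorem existsUnique_formalSolution : ∃! V : ℝ[X]⟦X⟧, IsFormalSolution V := by
  have hc : ∀ k, PowerSeries.constantCoeff (formalT^[k] 1) = 1 := by
    intro k
    cases k with
    | zero => simp
    | succ k => rw [Function.iterate_succ_apply']; exact constantCoeff_formalT
  have hd : ∀ k n, (PowerSeries.coeff n (formalT^[k] 1)).natDegree ≤ n := by
    intro k
    induction k with
    | zero => intro n; by_cases hn : n = 0 <;> simp [PowerSeries.coeff_one, hn]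
    | succ k ih =>
      rw [Function.iterate_succ_apply']
      exact natDegree_coeff_formalT ih (hc k)
  have hstep : ∀ k, PowerSeries.X ^ k ∣ formalT^[k + 1] 1 - formalT^[k] 1 := by
    intro k
    induction k with
    | zero => simp
    | succ k ih =>
      have := formalT_congr (hc (k + 1)) (hc k) ih
      rwa [← Function.iterate_succ_apply' formalT, ← Function.iterate_succ_apply' formalT] at this
  have hmono : ∀ k j, PowerSeries.X ^ k ∣ formalT^[k + j] 1 - formalT^[k] 1 := by
    intro k j
    induction j with
    | zero => simp
    | succ j ih =>
      have h1 := (pow_dvd_pow (PowerSeries.X : ℝ[X]⟦X⟧) (Nat.le_add_right k j)).trans (hstep (k + j))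
      have := dvd_add h1 ih
      rwa [sub_add_sub_cancel] at this
  let V : ℝ[X]⟦X⟧ := PowerSeries.mk fun n => PowerSeries.coeff n (formalT^[n + 1] 1)
  have hV : ∀ k, PowerSeries.X ^ k ∣ V - formalT^[k] 1 := by
    intro k
    rw [PowerSeries.X_pow_dvd_iff]
    intro m hm
    obtain ⟨j, rfl⟩ := Nat.exists_eq_add_of_le (Nat.succ_le_of_lt hm)
    have := PowerSeries.X_pow_dvd_iff.1 (hmono (m + 1) j) m (Nat.lt_succ_self m)
    rw [map_sub, sub_eq_zero] at this ⊢
    rw [PowerSeries.coeff_mk, Nat.succ_eq_add_one, this]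
  have hVc : PowerSeries.constantCoeff V = 1 := by
    rw [← PowerSeries.coeff_zero_eq_constantCoeff_apply, PowerSeries.coeff_mk,
      PowerSeries.coeff_zero_eq_constantCoeff_apply]
    exact hc _
  have hzero : ∀ U : ℝ[X]⟦X⟧, (∀ k, PowerSeries.X ^ k ∣ U) → U = 0 := by
    intro U hU
    ext1 n
    simpa using PowerSeries.X_pow_dvd_iff.1 (hU (n + 1)) n (Nat.lt_succ_self n)
  refine ⟨V, ⟨fun n => ?_, hVc, ?_⟩, ?_⟩
  · rw [PowerSeries.coeff_mk]
    exact hd _ _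
  · rw [← sub_eq_zero]
    refine hzero _ fun k => ?_
    have h1 := formalT_congr hVc (hc k) (hV k)
    rw [← Function.iterate_succ_apply' formalT] at h1
    have h2 := dvd_sub (hV (k + 1)) h1
    rw [sub_sub_sub_cancel_right] at h2
    exact (pow_dvd_pow _ (Nat.le_succ k)).trans h2
  · rintro W ⟨-, hWc, hW⟩
    have hVT : V = formalT V := by
      rw [← sub_eq_zero]
      refine hzero _ fun k => ?_
      have h1 := formalT_congr hVc (hc k) (hV k)
      rw [← Function.iterate_succ_apply' formalT] at h1
      have h2 := dvd_sub (hV (k + 1)) h1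
      rw [sub_sub_sub_cancel_right] at h2
      exact (pow_dvd_pow _ (Nat.le_succ k)).trans h2
    rw [← sub_eq_zero]
    refine hzero _ fun k => ?_
    induction k with
    | zero => simp
    | succ k ih =>
      rw [hW, hVT]
      exact formalT_congr hWc hVc ih

/-- The unique solution `V = 1 + ∑ₙ Pₙ₋₁(y) / xⁿ`. -/
def formalV : ℝ[X]⟦X⟧ := existsUnique_formalSolution.choose

theorem formalV_spec : IsFormalSolution formalV := existsUnique_formalSolution.choose_spec.1

/-- The polynomial `Pₙ`, the coefficient of `1 / xⁿ⁺¹` in `V`. -/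
def P (n : ℕ) : ℝ[X] := PowerSeries.coeff (n + 1) formalV

/-- `f_N(u) = x eˣ (1 + ∑_{n=1}^N Pₙ₋₁(log x) / xⁿ)` where `x = log u`. -/
def fN (N : ℕ) (u : ℝ) : ℝ :=
  Real.log u * u *
    (1 + ∑ n ∈ Finset.Icc 1 N, (P (n - 1)).eval (Real.log (Real.log u)) / Real.log u ^ n)

/-! ### The numbers `x_N` and `u_N` -/

/-- The numbers `aₙ` given by `log (1 - ∑ n! / xⁿ)⁻¹ = ∑ (aₙ / n) / xⁿ`, as formal power series in
`1 / x`, both sums being over `n ≥ 1`. -/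
def aSeq (n : ℕ) : ℝ :=
  n * PowerSeries.coeff n
    (PowerSeries.logOf ((1 - PowerSeries.mk fun k => if k = 0 then 0 else (k ! : ℝ))⁻¹))

/-- The least `c > 0` such that `x (1 - ∑_{n=1}^N n! / xⁿ) ≥ 1` for all `x ≥ c`. -/
def cN (N : ℕ) : ℝ :=
  sInf {c : ℝ | 0 < c ∧ ∀ x : ℝ, c ≤ x → 1 ≤ x * (1 - ∑ n ∈ Finset.Icc 1 N, (n ! : ℝ) / x ^ n)}

/-- The least `d > 0` such that for all complex `x` with `|x| ≥ d` the number
`log (1 - ∑_{n=1}^N n! / xⁿ)⁻¹` differs from `∑_{n=1}^N (aₙ / n) / xⁿ` by at most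
`(a_{N+1} / (N+1)) / |x|^{N+1}`. -/
def dN (N : ℕ) : ℝ :=
  sInf {d : ℝ | 0 < d ∧ ∀ x : ℂ, d ≤ ‖x‖ → ∃ θ : ℂ, ‖θ‖ ≤ 1 ∧
    Complex.log (1 - ∑ n ∈ Finset.Icc 1 N, (n ! : ℂ) / x ^ n)⁻¹
      = ∑ n ∈ Finset.Icc 1 N, ((aSeq n : ℂ) / n) * (1 / x ^ n)
        + θ * ((aSeq (N + 1) : ℂ) / (N + 1 : ℕ)) * (1 / x ^ (N + 1))}

/-- `α_N = max(e, c_N, d_N)`. -/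
def alphaN (N : ℕ) : ℝ := max (Real.exp 1) (max (cN N) (dN N))

/-- The solution `β_N ≥ e` of `x / log x = α_N`; it is unique. -/
def betaN (N : ℕ) : ℝ := sInf {x : ℝ | Real.exp 1 ≤ x ∧ x / Real.log x = alphaN N}

/-- `x_N = max(β_N, 4(N+1)/3, e²)`. -/
def xN (N : ℕ) : ℝ := max (betaN N) (max (4 * (N + 1 : ℝ) / 3) (Real.exp 2))

/-- `u_N = exp(x_N)`. -/
def uN (N : ℕ) : ℝ := Real.exp (xN N)

/-- `v ≥ u_N` is admissible if, for all `u > v`,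
`li(f_N(u)) - u = 13 θ (N+1)! u (log log u)^N / (log u)^{N+1}` with some `|θ| ≤ 1`. -/
def IsThreshold (N : ℕ) (v : ℝ) : Prop :=
  uN N ≤ v ∧ ∀ u : ℝ, v < u → ∃ θ : ℝ, |θ| ≤ 1 ∧
    li (fN N u) - u
      = θ * 13 * ((N + 1)! : ℝ) * (u * Real.log (Real.log u) ^ N / Real.log u ^ (N + 1))

/-- The number `v_N`, taken as the least admissible one: a bound for all `u ≥ v_N` then holds for
all `u ≥ v`, whichever admissible `v` is chosen. -/
def vN (N : ℕ) : ℝ := sInf {v : ℝ | IsThreshold N v}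

end AliExpansion

end

/-!
Put `x = log u`, `y = log x` and `S = 1 + ∑_{n ≤ N} Pₙ₋₁(y) / xⁿ`, so that `f_N(u) = u x S`. The
formal equation for `V` says that `f_N'(u)` is `x + y`, plus the truncation of the series `log V`,
minus the first omitted term `P_N(y) / x^N`, while `log f_N(u) = x + y + log S`. Hence the
derivative `f_N' / log f_N - 1` of `li (f_N(u)) - u` is, up to `O((y / x)^(N + 1) / x)`, equal to
`-P_N(y) / x^(N + 1)`. The coefficients of `yⁿ / xⁿ` in `V` have the generating function `1 + X`,
so those in `log V` have `log (1 + X)`; hence the leading term of `P_N(y)` is `± y^N / N`, and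
integration gives the bound for `li (f_N(u)) - u` for large `u`.

For `u > v_N` that bound is at most `10 u`, by the choice of `u_N`. So `f_N(u) > 1`, and `f_N(u)`
and `ali u` are both at most `ali (11 u) ≤ u²`. Since `ali' = log ∘ ali`, applying `ali` multiplies
the error by at most `2 log u`.
-/

noncomputable section

namespace AliExpansion

/-! ### Derivatives of `li` and `ali` -/

section LogIntegral

open Real

/-- The function `1 / log t` with its pole at `t = 1` subtracted. It takes values in `[0, 1]`, so
its integrals are the bounded part of `li`. -/
def regLog (t : ℝ) : ℝ := 1 / log t - 1 / (t - 1)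

theorem regLog_nonneg {t : ℝ} (ht : 0 ≤ t) : 0 ≤ regLog t := by
  obtain rfl | ht := ht.eq_or_lt
  · simp [regLog]
  have hlog : log t ≤ t - 1 := log_le_sub_one_of_pos ht
  rw [regLog, sub_nonneg]
  obtain hlt | rfl | hgt := lt_trichotomy t 1
  · exact one_div_le_one_div_of_neg_of_le (by linarith) hlog
  · simp
  · exact one_div_le_one_div_of_le (log_pos hgt) hlog

theorem regLog_add_regLog_inv {t : ℝ} (h0 : t ≠ 0) (h1 : t ≠ 1) :
    regLog t + regLog t⁻¹ = 1 := by
  have h : t - 1 ≠ 0 := sub_ne_zero.2 h1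
  have hinv : 1 / (t⁻¹ - 1) = -(t / (t - 1)) := by
    rw [← div_neg, neg_sub, one_div, ← inv_div, sub_div, div_self h0, one_div]
  rw [regLog, regLog, log_inv, hinv, one_div_neg_eq_neg_one_div]
  field_simp
  ring

theorem regLog_le_one {t : ℝ} (ht : 0 ≤ t) : regLog t ≤ 1 := by
  obtain rfl | h0 := eq_or_ne t 0
  · simp [regLog]
  obtain rfl | h1 := eq_or_ne t 1
  · simp [regLog]
  linarith [regLog_add_regLog_inv h0 h1, regLog_nonneg (inv_nonneg.2 ht)]

theorem measurable_regLog : Measurable regLog := by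
  unfold regLog
  fun_prop

theorem continuousAt_regLog {x : ℝ} (hx : 1 < x) : ContinuousAt regLog x := by
  have hlog : log x ≠ 0 := (log_pos hx).ne'
  have hsub : x - 1 ≠ 0 := by linarith
  have h0 : x ≠ 0 := by linarith
  unfold regLog
  fun_prop (disch := assumption)

theorem intervalIntegrable_regLog {a b : ℝ} (ha : 0 ≤ a) (hb : 0 ≤ b) :
    IntervalIntegrable regLog volume a b := by
  rw [intervalIntegrable_iff]
  refine Measure.integrableOn_of_bounded (M := 1) (by simp)
    measurable_regLog.aestronglyMeasurable ?_
  refine (ae_restrict_iff' measurableSet_uIoc).2 (Eventually.of_forall fun t ht => ?_)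
  have h0 : 0 ≤ t := (le_min ha hb).trans ht.1.le
  rw [norm_eq_abs, abs_of_nonneg (regLog_nonneg h0)]
  exact regLog_le_one h0

theorem integral_regLog_nonneg {a b : ℝ} (ha : 0 ≤ a) (hab : a ≤ b) :
    0 ≤ ∫ t in a..b, regLog t :=
  intervalIntegral.integral_nonneg hab fun _ ht => regLog_nonneg (ha.trans ht.1)

theorem integral_regLog_le {a b : ℝ} (ha : 0 ≤ a) (hab : a ≤ b) :
    ∫ t in a..b, regLog t ≤ b - a := by
  simpa using intervalIntegral.integral_mono_on hab
    (intervalIntegrable_regLog ha (ha.trans hab)) (_root_.intervalIntegrable_const (c := (1 : ℝ)))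
    fun _ ht => regLog_le_one (ha.trans ht.1)

theorem integral_one_div_log {a b : ℝ} (ha : 0 ≤ a) (hb : 0 ≤ b) (h : (1 : ℝ) ∉ Set.uIcc a b) :
    ∫ t in a..b, 1 / log t = (∫ t in a..b, regLog t) + (log (b - 1) - log (a - 1)) := by
  have hne : ∀ t ∈ Set.uIcc a b, t - 1 ≠ 0 :=
    fun t ht => sub_ne_zero.2 (ne_of_mem_of_not_mem ht h)
  have hderiv : ∀ t ∈ Set.uIcc a b, HasDerivAt (fun s => log (s - 1)) (1 / (t - 1)) t :=
    fun t ht => ((hasDerivAt_id t).sub_const 1).log (hne t ht)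
  have hint : IntervalIntegrable (fun t : ℝ => 1 / (t - 1)) volume a b :=
    (continuousOn_const.div (by fun_prop) hne).intervalIntegrable
  rw [← intervalIntegral.integral_eq_sub_of_hasDerivAt hderiv hint,
    ← intervalIntegral.integral_add (intervalIntegrable_regLog ha hb) hint]
  simp [regLog]

-- The two logarithmic terms `log ε` at the ends of the excised interval cancel.
theorem liTrunc_eq {x ε : ℝ} (h0 : 0 < ε) (h1 : ε < 1) (hx : ε < x - 1) :
    liTrunc x ε = log (x - 1) + (∫ t in (0 : ℝ)..x, regLog t)
      - ∫ t in (1 - ε)..(1 + ε), regLog t := by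
  have hleft := integral_one_div_log (a := 0) (b := 1 - ε) le_rfl (by linarith)
    (Set.notMem_uIcc_of_gt (by linarith) (by linarith))
  have hright := integral_one_div_log (a := 1 + ε) (b := x) (by linarith) (by linarith)
    (Set.notMem_uIcc_of_lt (by linarith) (by linarith))
  have hsplit₁ := intervalIntegral.integral_add_adjacent_intervals
    (intervalIntegrable_regLog (a := 0) (b := 1 - ε) le_rfl (by linarith))
    (intervalIntegrable_regLog (b := 1 + ε) (by linarith) (by linarith))
  have hsplit₂ := intervalIntegral.integral_add_adjacent_intervals
    (intervalIntegrable_regLog (a := 0) (b := 1 + ε) le_rfl (by linarith))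
    (intervalIntegrable_regLog (b := x) (by linarith) (by linarith))
  rw [liTrunc, hleft, hright, sub_sub_cancel_left, add_sub_cancel_left, log_neg_eq_log, zero_sub,
    log_neg_eq_log, log_one]
  linarith

theorem tendsto_liTrunc {x : ℝ} (hx : 1 < x) :
    Tendsto (liTrunc x) (𝓝[>] 0) (𝓝 (log (x - 1) + ∫ t in (0 : ℝ)..x, regLog t)) := by
  set l := log (x - 1) + ∫ t in (0 : ℝ)..x, regLog t
  have hlim : Tendsto (fun ε : ℝ => l - 2 * ε) (𝓝[>] 0) (𝓝 l) := by
    have h : Tendsto (fun ε : ℝ => l - 2 * ε) (𝓝 0) (𝓝 (l - 2 * 0)) :=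
      Continuous.tendsto (by fun_prop) 0
    rw [mul_zero, sub_zero] at h
    exact h.mono_left nhdsWithin_le_nhds
  have hsmall : ∀ᶠ ε in 𝓝[>] (0 : ℝ), 0 < ε ∧ ε < min 1 (x - 1) :=
    Ioo_mem_nhdsGT (lt_min one_pos (by linarith))
  refine tendsto_of_tendsto_of_tendsto_of_le_of_le' hlim tendsto_const_nhds ?_ ?_
  · filter_upwards [hsmall] with ε ⟨h0, h1⟩
    rw [lt_min_iff] at h1
    rw [liTrunc_eq h0 h1.1 h1.2]
    linarith [integral_regLog_le (a := 1 - ε) (b := 1 + ε) (by linarith) (by linarith)]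
  · filter_upwards [hsmall] with ε ⟨h0, h1⟩
    rw [lt_min_iff] at h1
    rw [liTrunc_eq h0 h1.1 h1.2]
    linarith [integral_regLog_nonneg (a := 1 - ε) (b := 1 + ε) (by linarith) (by linarith)]

theorem li_eq {x : ℝ} (hx : 1 < x) : li x = log (x - 1) + ∫ t in (0 : ℝ)..x, regLog t :=
  (tendsto_liTrunc hx).limUnder_eq

theorem hasDerivAt_li {x : ℝ} (hx : 1 < x) : HasDerivAt li (log x)⁻¹ x := by
  have hint : HasDerivAt (fun y => ∫ t in (0 : ℝ)..y, regLog t) (regLog x) x :=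
    intervalIntegral.integral_hasDerivAt_right
      (intervalIntegrable_regLog le_rfl (by linarith : 0 ≤ x))
      measurable_regLog.stronglyMeasurable.stronglyMeasurableAtFilter (continuousAt_regLog hx)
  have hlog : HasDerivAt (fun y => log (y - 1)) (1 / (x - 1)) x :=
    ((hasDerivAt_id x).sub_const 1).log (sub_ne_zero.2 hx.ne')
  have hsum := hlog.add hint
  rw [regLog, add_sub_cancel, one_div] at hsum
  exact hsum.congr_of_eventuallyEq <| (lt_mem_nhds hx).mono fun _ => li_eq

theorem continuousOn_li : ContinuousOn li (Set.Ioi 1) := fun _ hx =>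
  (hasDerivAt_li hx).continuousAt.continuousWithinAt

theorem strictMonoOn_li : StrictMonoOn li (Set.Ioi 1) := by
  refine strictMonoOn_of_deriv_pos (convex_Ioi 1) continuousOn_li fun x hx => ?_
  rw [interior_Ioi] at hx
  rw [(hasDerivAt_li hx).deriv]
  exact inv_pos.2 (log_pos hx)

theorem log_sub_one_le_li {x : ℝ} (hx : 1 < x) : log (x - 1) ≤ li x := by
  rw [li_eq hx]
  linarith [integral_regLog_nonneg le_rfl (by linarith : 0 ≤ x)]

theorem li_le_log_sub_one_add {x : ℝ} (hx : 1 < x) : li x ≤ log (x - 1) + x := by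
  rw [li_eq hx]
  linarith [integral_regLog_le le_rfl (by linarith : 0 ≤ x)]

theorem tendsto_li_atTop : Tendsto li atTop atTop :=
  tendsto_atTop_mono' atTop ((eventually_gt_atTop 1).mono fun _ => log_sub_one_le_li)
    (tendsto_log_atTop.comp (tendsto_atTop_add_const_right _ (-1) tendsto_id))

theorem tendsto_li_nhdsGT_one : Tendsto li (𝓝[>] 1) atBot := by
  have hgt : ∀ᶠ x : ℝ in 𝓝[>] 1, 1 < x := eventually_mem_nhdsWithin
  have hsub : Tendsto (fun x : ℝ => x - 1) (𝓝[>] 1) (𝓝[>] 0) := by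
    have hcont : Continuous fun x : ℝ => x - 1 := by fun_prop
    exact tendsto_nhdsWithin_iff.2
      ⟨(hcont.tendsto' 1 0 (sub_self 1)).mono_left nhdsWithin_le_nhds, hgt.mono fun x => sub_pos.2⟩
  have hsum : Tendsto (fun x => log (x - 1) + x) (𝓝[>] 1) atBot :=
    (tendsto_log_nhdsGT_zero.comp hsub).atBot_add (tendsto_id.mono_left nhdsWithin_le_nhds)
  exact tendsto_atBot_mono' _ (hgt.mono fun x => li_le_log_sub_one_add) hsum

theorem surjOn_li : Set.SurjOn li (Set.Ioi 1) Set.univ :=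
  isPreconnected_Ioi.intermediate_value_Iii (l₁ := 𝓝[>] 1) inf_le_right
    (le_principal_iff.2 (Ioi_mem_atTop 1)) continuousOn_li tendsto_li_nhdsGT_one tendsto_li_atTop

theorem sub_two_div_log_le_li {y : ℝ} (hy : 2 ≤ y) : (y - 2) / log y ≤ li y := by
  have hmono : (log y)⁻¹ * (y - 2) ≤ li y - li 2 := by
    refine (convex_Icc 2 y).mul_sub_le_image_sub_of_le_deriv
      (continuousOn_li.mono fun t ht => one_lt_two.trans_le ht.1)
      (fun t ht => ?_) (fun t ht => ?_) 2 ⟨le_rfl, hy⟩ y ⟨hy, le_rfl⟩ hy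
    all_goals
      rw [interior_Icc] at ht
      have ht1 : 1 < t := one_lt_two.trans ht.1
    · exact (hasDerivAt_li ht1).differentiableAt.differentiableWithinAt
    · rw [(hasDerivAt_li ht1).deriv]
      exact inv_anti₀ (log_pos ht1) (log_le_log (by linarith) ht.2.le)
  have hli2 : 0 ≤ li 2 := by
    simpa only [show (2 : ℝ) - 1 = 1 by norm_num, log_one] using log_sub_one_le_li one_lt_two
  rw [div_eq_inv_mul]
  linarith

theorem one_lt_ali (u : ℝ) : 1 < ali u :=
  Function.invFunOn_mem (surjOn_li (Set.mem_univ u))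

theorem li_ali (u : ℝ) : li (ali u) = u :=
  Function.invFunOn_eq (surjOn_li (Set.mem_univ u))

theorem ali_li {x : ℝ} (hx : 1 < x) : ali (li x) = x :=
  strictMonoOn_li.injOn (one_lt_ali _) hx (li_ali _)

theorem strictMono_ali : StrictMono ali := fun a b hab =>
  (strictMonoOn_li.lt_iff_lt (one_lt_ali a) (one_lt_ali b)).1 (by rwa [li_ali, li_ali])

theorem continuous_ali : Continuous ali := by
  refine continuous_iff_continuousAt.2 fun u =>
    continuousAt_of_monotoneOn_of_image_mem_nhds (s := Set.univ)
      (strictMono_ali.monotone.monotoneOn _) univ_mem ?_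
  exact mem_of_superset (Ioi_mem_nhds (one_lt_ali u)) fun x hx => ⟨li x, trivial, ali_li hx⟩

theorem hasDerivAt_ali (u : ℝ) : HasDerivAt ali (log (ali u)) u := by
  have h := (hasDerivAt_li (one_lt_ali u)).of_local_left_inverse continuous_ali.continuousAt
    (inv_ne_zero (log_pos (one_lt_ali u)).ne') (Eventually.of_forall li_ali)
  rwa [inv_inv] at h

theorem abs_ali_sub_ali_le {a b c : ℝ} (ha : a ≤ c) (hb : b ≤ c) :
    |ali b - ali a| ≤ log (ali c) * |b - a| := by
  refine (convex_Iic c).norm_image_sub_le_of_norm_hasDerivWithin_le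
    (fun u _ => (hasDerivAt_ali u).hasDerivWithinAt) (fun u hu => ?_) ha hb
  have h1 := one_lt_ali u
  rw [norm_of_nonneg (log_nonneg h1.le)]
  exact log_le_log (by linarith) (strictMono_ali.monotone hu)

theorem twentyThree_mul_le_exp {x : ℝ} (hx : 7 ≤ x) : 23 * x ≤ exp x := by
  have hpow : (7 : ℝ) ^ 5 ≤ x ^ 5 := by gcongr
  have htaylor : x ^ 6 / 6 ! ≤ exp x := pow_div_factorial_le_exp x (by linarith) 6
  have hfac : ((6 ! : ℕ) : ℝ) = 720 := by norm_num [Nat.factorial]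
  rw [hfac, pow_succ] at htaylor
  nlinarith

theorem ali_eleven_mul_le_sq {u : ℝ} (hu0 : 0 < u) (hu : 7 ≤ log u) : ali (11 * u) ≤ u ^ 2 := by
  have hlog : 23 * log u ≤ u := by simpa only [exp_log hu0] using twentyThree_mul_le_exp hu
  have hsq : 2 ≤ u ^ 2 := by nlinarith
  have hle : 11 * u ≤ (u ^ 2 - 2) / log (u ^ 2) := by
    rw [log_pow, Nat.cast_ofNat, le_div_iff₀ (by linarith)]
    nlinarith
  have h1 : 1 < u ^ 2 := by linarith
  rw [← ali_li h1]
  exact strictMono_ali.monotone (hle.trans (sub_two_div_log_le_li hsq))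

end LogIntegral

/-! ### The top-degree coefficients of the formal solution -/

section TopDegree

open PowerSeries (coeff constantCoeff logOf)

theorem derivative_logOf {A : Type*} [CommRing A] [Algebra ℚ A] {f : A⟦X⟧}
    (hf : constantCoeff f = 1) :
    PowerSeries.derivative A (logOf f) * f = PowerSeries.derivative A f := by
  have hs : PowerSeries.HasSubst (f - 1) := .of_constantCoeff_zero' (by simp [hf])
  have hlog : PowerSeries.derivative A (PowerSeries.log A) * (1 + PowerSeries.X) = 1 := by
    rw [PowerSeries.deriv_log]
    ext n
    cases n with
    | zero => simp
    | succ n => simp [mul_add, PowerSeries.coeff_succ_mul_X, pow_succ, PowerSeries.coeff_one]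
  have hone : PowerSeries.subst (f - 1) (1 : A⟦X⟧) = 1 := by
    rw [← PowerSeries.coe_substAlgHom hs, map_one]
  have hsubst := congrArg (PowerSeries.subst (f - 1)) hlog
  rw [PowerSeries.subst_mul hs, PowerSeries.subst_add hs, PowerSeries.subst_X hs, hone,
    add_sub_cancel] at hsubst
  rw [logOf, PowerSeries.derivative_subst hs, mul_right_comm, hsubst, one_mul, map_sub,
    Derivation.map_one_eq_zero, sub_zero]

/-- The series `∑ cₙ Xⁿ` where `cₙ` is the coefficient of `yⁿ` in the coefficient of `Xⁿ` in `V`.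
For series whose `n`-th coefficient has degree at most `n` it is multiplicative in `V`. -/
def topSeries {R : Type*} [Semiring R] (V : R[X]⟦X⟧) : R⟦X⟧ :=
  PowerSeries.mk fun n => (coeff n V).coeff n

theorem coeff_topSeries {R : Type*} [Semiring R] (V : R[X]⟦X⟧) (n : ℕ) :
    coeff n (topSeries V) = (coeff n V).coeff n :=
  PowerSeries.coeff_mk n _

theorem topSeries_mul {R : Type*} [Semiring R] {U V : R[X]⟦X⟧}
    (hU : ∀ n, (coeff n U).natDegree ≤ n) (hV : ∀ n, (coeff n V).natDegree ≤ n) :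
    topSeries (U * V) = topSeries U * topSeries V := by
  ext n
  simp only [coeff_topSeries, PowerSeries.coeff_mul, Polynomial.finsetSum_coeff]
  refine Finset.sum_congr rfl fun p hp => ?_
  rw [← Finset.HasAntidiagonal.mem_antidiagonal.1 hp]
  exact Polynomial.coeff_mul_add_eq_of_natDegree_le (hU p.1) (hV p.2)

theorem coeff_X_mul_derivative {R : Type*} [CommSemiring R] (V : R⟦X⟧) (n : ℕ) :
    coeff n (PowerSeries.X * PowerSeries.derivative R V) = n * coeff n V := by
  cases n with
  | zero => simp
  | succ n =>
    rw [PowerSeries.coeff_succ_X_mul, PowerSeries.coeff_derivative, mul_comm, Nat.cast_succ]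

theorem topSeries_X_mul_derivative {R : Type*} [CommSemiring R] (V : R[X]⟦X⟧) :
    topSeries (PowerSeries.X * PowerSeries.derivative R[X] V)
      = PowerSeries.X * PowerSeries.derivative R (topSeries V) := by
  ext n
  simp only [coeff_topSeries, coeff_X_mul_derivative, Polynomial.coeff_natCast_mul]

theorem topSeries_logOf {V : ℝ[X]⟦X⟧} (hV : ∀ n, (coeff n V).natDegree ≤ n)
    (h1 : constantCoeff V = 1) : topSeries (logOf V) = logOf (topSeries V) := by
  have htop : constantCoeff (topSeries V) = 1 := by
    rw [← PowerSeries.coeff_zero_eq_constantCoeff_apply, coeff_topSeries,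
      PowerSeries.coeff_zero_eq_constantCoeff_apply, h1, Polynomial.coeff_one_zero]
  have hdeg : ∀ n, (coeff n (PowerSeries.X * PowerSeries.derivative ℝ[X] (logOf V))).natDegree
      ≤ n := fun n => by
    rw [coeff_X_mul_derivative, ← nsmul_eq_mul]
    exact (Polynomial.natDegree_smul_le _ _).trans (natDegree_coeff_logOf hV h1 n)
  have hmul : PowerSeries.X * PowerSeries.derivative ℝ (topSeries (logOf V)) * topSeries V
      = PowerSeries.X * PowerSeries.derivative ℝ (logOf (topSeries V)) * topSeries V := by
    rw [← topSeries_X_mul_derivative, ← topSeries_mul hdeg hV, mul_assoc, derivative_logOf h1,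
      topSeries_X_mul_derivative, mul_assoc, derivative_logOf htop]
  have hne : topSeries V ≠ 0 := fun h => by simp [h] at htop
  refine PowerSeries.derivative.ext ?_ ?_
  · exact mul_left_cancel₀ PowerSeries.X_ne_zero (mul_right_cancel₀ hne hmul)
  · rw [PowerSeries.constantCoeff_logOf htop, ← PowerSeries.coeff_zero_eq_constantCoeff_apply,
      coeff_topSeries, PowerSeries.coeff_zero_eq_constantCoeff_apply,
      PowerSeries.constantCoeff_logOf h1, Polynomial.coeff_zero]

/-- The operator `x d/dx` along the curve `y = log x`: it sends `∑ qₙ(y) / xⁿ` to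
`∑ (qₙ'(y) - n qₙ(y)) / xⁿ`. -/
def eulerDeriv (V : ℝ[X]⟦X⟧) : ℝ[X]⟦X⟧ :=
  derivY V - PowerSeries.X * PowerSeries.derivative ℝ[X] V

theorem coeff_eulerDeriv (V : ℝ[X]⟦X⟧) (n : ℕ) :
    coeff n (eulerDeriv V) = (coeff n V).derivative - (n : ℝ[X]) * coeff n V := by
  rw [eulerDeriv, map_sub, derivY, PowerSeries.coeff_mk, coeff_X_mul_derivative]

theorem formalV_eq :
    formalV = 1 + PowerSeries.X *
      (PowerSeries.C Polynomial.X - formalV - eulerDeriv formalV + logOf formalV) := by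
  conv_lhs => rw [formalV_spec.2.2, formalT, derivX]
  rw [eulerDeriv]
  ring

theorem coeff_succ_formalV (n : ℕ) :
    coeff (n + 1) formalV = (if n = 0 then Polynomial.X else 0) - coeff n formalV
      - ((coeff n formalV).derivative - (n : ℝ[X]) * coeff n formalV)
      + coeff n (logOf formalV) := by
  conv_lhs => rw [formalV_eq]
  rw [map_add, PowerSeries.coeff_one, if_neg n.succ_ne_zero, zero_add,
    PowerSeries.coeff_succ_X_mul, map_add, map_sub, map_sub, PowerSeries.coeff_C, coeff_eulerDeriv]

theorem coeff_eq_zero_of_lt {V : ℝ[X]⟦X⟧} (hV : ∀ n, (coeff n V).natDegree ≤ n) {n m : ℕ}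
    (h : n < m) : (coeff n V).coeff m = 0 :=
  Polynomial.coeff_eq_zero_of_natDegree_lt ((hV n).trans_lt h)

theorem topSeries_formalV : topSeries formalV = 1 + PowerSeries.X := by
  obtain ⟨hV, h1, -⟩ := formalV_spec
  ext n
  cases n with
  | zero =>
    rw [coeff_topSeries, PowerSeries.coeff_zero_eq_constantCoeff_apply, h1]
    simp
  | succ n =>
    have hlog := natDegree_coeff_logOf hV h1
    rw [coeff_topSeries, coeff_succ_formalV]
    simp only [Polynomial.coeff_add, Polynomial.coeff_sub, Polynomial.coeff_derivative,
      Polynomial.coeff_natCast_mul, coeff_eq_zero_of_lt hV (by omega : n < n + 1),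
      coeff_eq_zero_of_lt hV (by omega : n < n + 1 + 1),
      coeff_eq_zero_of_lt hlog (by omega : n < n + 1)]
    by_cases hn : n = 0 <;> simp [hn, PowerSeries.coeff_X, PowerSeries.coeff_one]

theorem natDegree_P_le {N : ℕ} (hN : 1 ≤ N) : (P N).natDegree ≤ N := by
  refine Polynomial.natDegree_le_iff_coeff_eq_zero.2 fun m hm => ?_
  obtain rfl | hlt := (Nat.succ_le_of_lt hm).eq_or_lt
  · have htop := congrArg (coeff (N + 1)) topSeries_formalV
    rw [coeff_topSeries] at htop
    simpa [P, PowerSeries.coeff_one, PowerSeries.coeff_X, Nat.one_le_iff_ne_zero.1 hN] using htop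
  · exact coeff_eq_zero_of_lt formalV_spec.1 hlt

theorem coeff_P {N : ℕ} (hN : 1 ≤ N) : (P N).coeff N = (-1) ^ (N + 1) / N := by
  obtain ⟨hV, h1, -⟩ := formalV_spec
  have hN0 : N ≠ 0 := Nat.one_le_iff_ne_zero.1 hN
  have hlog : (coeff N (logOf formalV)).coeff N = (-1) ^ (N + 1) / N := by
    rw [← coeff_topSeries, topSeries_logOf hV h1, topSeries_formalV, PowerSeries.logOf_one_add_X,
      PowerSeries.coeff_log, if_neg hN0]
    simp
  have htop : (coeff N formalV).coeff N = if N = 1 then 1 else 0 := by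
    rw [← coeff_topSeries, topSeries_formalV]
    simp [PowerSeries.coeff_one, PowerSeries.coeff_X, hN0]
  rw [P, coeff_succ_formalV, if_neg hN0]
  simp only [Polynomial.coeff_add, Polynomial.coeff_sub, Polynomial.coeff_derivative,
    Polynomial.coeff_natCast_mul, coeff_eq_zero_of_lt hV (Nat.lt_succ_self N), htop, hlog]
  by_cases h : N = 1 <;> simp [h]

theorem tendsto_eval_P_div_pow {N : ℕ} (hN : 1 ≤ N) :
    Tendsto (fun y => (P N).eval y / y ^ N) atTop (𝓝 ((-1) ^ (N + 1) / N)) := by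
  have hcoeff : (P N).coeff N ≠ 0 := by
    rw [coeff_P hN]
    positivity
  have hdeg : (P N).natDegree = N :=
    Polynomial.natDegree_eq_of_le_of_coeff_ne_zero (natDegree_P_le hN) hcoeff
  have h0 : P N ≠ 0 := fun h => by simp [h] at hcoeff
  have h := (P N).div_tendsto_atTop_leadingCoeff_div_of_degree_eq (Polynomial.X ^ N)
    (by rw [Polynomial.degree_X_pow, Polynomial.degree_eq_natDegree h0, hdeg])
  simpa [Polynomial.leadingCoeff, hdeg, coeff_P hN] using h

end TopDegree

/-! ### Partial sums of a series and of its logarithm -/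

section PartialSums

open PowerSeries (coeff constantCoeff logOf trunc)

/-- The sum of the terms with `n ≤ N` of the series `∑ qₙ(y) tⁿ` with coefficients `qₙ ∈ ℝ[y]`, at
real numbers `y` and `t = 1 / x`. -/
def partialSum (V : ℝ[X]⟦X⟧) (N : ℕ) (y t : ℝ) : ℝ :=
  ∑ n ∈ Finset.range (N + 1), (coeff n V).eval y * t ^ n

theorem evalEval_trunc (V : ℝ[X]⟦X⟧) (N : ℕ) (y t : ℝ) :
    (trunc (N + 1) V).evalEval y t = partialSum V N y t := by
  rw [← Polynomial.map_evalRingHom_eval, Polynomial.eval_map,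
    Polynomial.eval₂_eq_sum_range' _ (PowerSeries.natDegree_trunc_lt V N), partialSum]
  refine Finset.sum_congr rfl fun n hn => ?_
  rw [PowerSeries.coeff_trunc, if_pos (Finset.mem_range.1 hn), Polynomial.coe_evalRingHom]

theorem partialSum_zero_right (V : ℝ[X]⟦X⟧) (N : ℕ) (y : ℝ) :
    partialSum V N y 0 = (constantCoeff V).eval y := by
  simp [partialSum, Finset.sum_range_succ']

theorem partialSum_add (U V : ℝ[X]⟦X⟧) (N : ℕ) (y t : ℝ) :
    partialSum (U + V) N y t = partialSum U N y t + partialSum V N y t := by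
  simp only [partialSum, map_add, Polynomial.eval_add, add_mul, Finset.sum_add_distrib]

theorem partialSum_sub (U V : ℝ[X]⟦X⟧) (N : ℕ) (y t : ℝ) :
    partialSum (U - V) N y t = partialSum U N y t - partialSum V N y t := by
  simp only [partialSum, map_sub, Polynomial.eval_sub, sub_mul, Finset.sum_sub_distrib]

theorem partialSum_C (p : ℝ[X]) (N : ℕ) (y t : ℝ) :
    partialSum (PowerSeries.C p) N y t = p.eval y := by
  simp [partialSum, Finset.sum_range_succ', PowerSeries.coeff_C]

theorem partialSum_one_add_X_mul (V : ℝ[X]⟦X⟧) (N : ℕ) (y t : ℝ) :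
    partialSum (1 + PowerSeries.X * V) (N + 1) y t = 1 + t * partialSum V N y t := by
  rw [partialSum, Finset.sum_range_succ', partialSum, Finset.mul_sum, add_comm]
  simp [PowerSeries.coeff_one, PowerSeries.coeff_succ_X_mul, pow_succ', mul_left_comm]

theorem hasDerivAt_evalEval (p : ℝ[X][X]) (y t : ℝ) :
    HasDerivAt (fun t => p.evalEval y t) (p.derivative.evalEval y t) t := by
  simp only [← Polynomial.map_evalRingHom_eval, ← Polynomial.derivative_map]
  exact Polynomial.hasDerivAt _ t

theorem exists_abs_eval_le {p : ℝ[X]} {m : ℕ} (hp : p.natDegree ≤ m) :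
    ∃ C : ℝ, 0 ≤ C ∧ ∀ y : ℝ, 1 ≤ y → |p.eval y| ≤ C * y ^ m := by
  refine ⟨∑ i ∈ Finset.range (m + 1), |p.coeff i|,
    Finset.sum_nonneg fun _ _ => abs_nonneg _, fun y hy => ?_⟩
  rw [Polynomial.eval_eq_sum_range' (Nat.lt_succ_of_le hp), Finset.sum_mul]
  refine (Finset.abs_sum_le_sum_abs _ _).trans (Finset.sum_le_sum fun i hi => ?_)
  rw [abs_mul, abs_of_nonneg (by positivity : 0 ≤ y ^ i)]
  gcongr
  exact Finset.mem_range_succ_iff.1 hi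

theorem exists_abs_evalEval_le {p : ℝ[X][X]} {m k : ℕ}
    (hp : ∀ n, (p.coeff n).natDegree ≤ n + k) (h0 : ∀ n < m, p.coeff n = 0) :
    ∃ C : ℝ, 0 ≤ C ∧ ∀ y t : ℝ, 1 ≤ y → 0 ≤ t → y * t ≤ 1 →
      |p.evalEval y t| ≤ C * (y ^ (m + k) * t ^ m) := by
  choose c hc0 hc using fun n => exists_abs_eval_le (hp n)
  refine ⟨∑ n ∈ Finset.range (p.natDegree + 1), c n, Finset.sum_nonneg fun _ _ => hc0 _,
    fun y t hy ht hyt => ?_⟩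
  rw [← Polynomial.map_evalRingHom_eval, Polynomial.eval_map, Polynomial.eval₂_eq_sum_range,
    Finset.sum_mul]
  refine (Finset.abs_sum_le_sum_abs _ _).trans (Finset.sum_le_sum fun n _ => ?_)
  obtain hn | hn := lt_or_ge n m
  · have := hc0 n
    rw [h0 n hn, map_zero, zero_mul, abs_zero]
    positivity
  · obtain ⟨j, rfl⟩ := Nat.exists_eq_add_of_le hn
    have := hc0 (m + j)
    rw [Polynomial.coe_evalRingHom, abs_mul, abs_of_nonneg (by positivity : 0 ≤ t ^ (m + j))]
    calc |(p.coeff (m + j)).eval y| * t ^ (m + j)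
        ≤ c (m + j) * y ^ (m + j + k) * t ^ (m + j) := by gcongr; exact hc _ y hy
      _ = c (m + j) * (y ^ (m + k) * t ^ m) * (y * t) ^ j := by ring
      _ ≤ c (m + j) * (y ^ (m + k) * t ^ m) :=
        mul_le_of_le_one_right (by positivity) (pow_le_one₀ (by positivity) hyt)

theorem natDegree_coeff_trunc_le {V : ℝ[X]⟦X⟧} (hV : ∀ n, (coeff n V).natDegree ≤ n) (m n : ℕ) :
    ((trunc m V).coeff n).natDegree ≤ n := by
  rw [PowerSeries.coeff_trunc]
  split_ifs
  · exact hV n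
  · simp

theorem natDegree_coeff_derivative_le {p : ℝ[X][X]} (hp : ∀ n, (p.coeff n).natDegree ≤ n)
    (n : ℕ) : (p.derivative.coeff n).natDegree ≤ n + 1 := by
  rw [Polynomial.coeff_derivative, ← Nat.cast_succ, ← nsmul_eq_mul']
  exact (Polynomial.natDegree_smul_le _ _).trans (hp (n + 1))

theorem coeff_derivative_trunc_sub_eq_zero {A : Type*} [CommRing A] [Algebra ℚ A] {f : A⟦X⟧}
    (hf : constantCoeff f = 1) {n N : ℕ} (hn : n < N) :
    ((trunc (N + 1) f).derivative
      - trunc (N + 1) f * (trunc (N + 1) (logOf f)).derivative).coeff n = 0 := by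
  rw [← PowerSeries.trunc_derivative, ← PowerSeries.trunc_derivative, Polynomial.coeff_sub,
    PowerSeries.coeff_trunc, if_pos hn, ← Polynomial.coeff_coe, Polynomial.coe_mul,
    ← PowerSeries.coeff_mul_eq_coeff_trunc_mul_trunc₂ _ _ (hn.trans (Nat.lt_succ_self N)) hn,
    mul_comm, derivative_logOf hf, sub_self]

variable {V : ℝ[X]⟦X⟧}

theorem exists_half_le_partialSum (hV : ∀ n, (coeff n V).natDegree ≤ n)
    (h1 : constantCoeff V = 1) (N : ℕ) :
    ∃ δ : ℝ, 0 < δ ∧ δ ≤ 1 ∧ ∀ y t : ℝ, 1 ≤ y → 0 ≤ t → y * t ≤ δ →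
      1 / 2 ≤ partialSum V N y t := by
  obtain ⟨C, hC0, hC⟩ := exists_abs_evalEval_le (p := trunc (N + 1) V - 1) (m := 1) (k := 0)
    (fun n => by
      rw [Polynomial.coeff_sub, Polynomial.coeff_one]
      refine (Polynomial.natDegree_sub_le _ _).trans (max_le (natDegree_coeff_trunc_le hV _ n) ?_)
      split_ifs <;> simp)
    (fun n hn => by simp [Nat.lt_one_iff.1 hn, PowerSeries.coeff_trunc, h1])
  have hδ1 : 1 / (2 * (C + 1)) ≤ 1 := by
    rw [div_le_one (by positivity)]
    linarith
  refine ⟨1 / (2 * (C + 1)), by positivity, hδ1, fun y t hy ht hyt => ?_⟩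
  have hdiff := hC y t hy ht (hyt.trans hδ1)
  rw [Polynomial.evalEval_sub, evalEval_trunc, Polynomial.evalEval_one, pow_one, pow_one]
    at hdiff
  rw [le_div_iff₀ (by positivity)] at hyt
  have hyt0 : 0 ≤ y * t := by positivity
  linarith [(abs_le.1 hdiff).1]

theorem exists_abs_derivative_sub_mul_derivative_le (hV : ∀ n, (coeff n V).natDegree ≤ n)
    (h1 : constantCoeff V = 1) (N : ℕ) :
    ∃ C : ℝ, 0 ≤ C ∧ ∀ y t : ℝ, 1 ≤ y → 0 ≤ t → y * t ≤ 1 →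
      |(trunc (N + 1) V).derivative.evalEval y t
        - partialSum V N y t * (trunc (N + 1) (logOf V)).derivative.evalEval y t|
        ≤ C * (y ^ (N + 1) * t ^ N) := by
  have hT := natDegree_coeff_trunc_le hV (N + 1)
  have hL := natDegree_coeff_trunc_le (natDegree_coeff_logOf hV h1) (N + 1)
  obtain ⟨C, hC0, hC⟩ := exists_abs_evalEval_le (m := N) (k := 1)
    (p := (trunc (N + 1) V).derivative
      - trunc (N + 1) V * (trunc (N + 1) (logOf V)).derivative)
    (fun n => by
      rw [Polynomial.coeff_sub, Polynomial.coeff_mul]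
      refine (Polynomial.natDegree_sub_le _ _).trans (max_le (natDegree_coeff_derivative_le hT n)
        (Polynomial.natDegree_sum_le_of_forall_le _ _ fun ij hij => ?_))
      have hsum := Finset.HasAntidiagonal.mem_antidiagonal.1 hij
      have hleft := hT ij.1
      have hright := natDegree_coeff_derivative_le hL ij.2
      exact Polynomial.natDegree_mul_le.trans (by omega))
    (fun n hn => coeff_derivative_trunc_sub_eq_zero h1 hn)
  refine ⟨C, hC0, fun y t hy ht hyt => ?_⟩
  simpa only [Polynomial.evalEval_sub, Polynomial.evalEval_mul, evalEval_trunc]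
    using hC y t hy ht hyt

-- With `S` and `L` the partial sums of `V` and `log V`, the derivative of `log S - L` in `t` is
-- `(∂S - S ∂L) / S`.
theorem exists_abs_log_partialSum_sub_le (hV : ∀ n, (coeff n V).natDegree ≤ n)
    (h1 : constantCoeff V = 1) (N : ℕ) :
    ∃ C δ : ℝ, 0 < δ ∧ ∀ y t : ℝ, 1 ≤ y → 0 ≤ t → y * t ≤ δ →
      1 / 2 ≤ partialSum V N y t ∧
      |Real.log (partialSum V N y t) - partialSum (logOf V) N y t| ≤ C * (y * t) ^ (N + 1) := by
  obtain ⟨δ, hδ0, hδ1, hlow⟩ := exists_half_le_partialSum hV h1 N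
  obtain ⟨C, hC0, hC⟩ := exists_abs_derivative_sub_mul_derivative_le hV h1 N
  refine ⟨2 * C, δ, hδ0, fun y t hy ht hyt => ⟨hlow y t hy ht hyt, ?_⟩⟩
  have hys : ∀ s ∈ Set.Icc 0 t, y * s ≤ δ := fun s hs =>
    (mul_le_mul_of_nonneg_left hs.2 (by linarith)).trans hyt
  have hderiv : ∀ s ∈ Set.Icc 0 t, HasDerivWithinAt
      (fun s => Real.log (partialSum V N y s) - partialSum (logOf V) N y s)
      ((trunc (N + 1) V).derivative.evalEval y s / partialSum V N y s
        - (trunc (N + 1) (logOf V)).derivative.evalEval y s) (Set.Icc 0 t) s := fun s hs => by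
    have hS := hlow y s hy hs.1 (hys s hs)
    simp only [← evalEval_trunc] at hS ⊢
    exact (((hasDerivAt_evalEval _ y s).log (by linarith)).sub
      (hasDerivAt_evalEval _ y s)).hasDerivWithinAt
  have hbound : ∀ s ∈ Set.Icc 0 t, ‖(trunc (N + 1) V).derivative.evalEval y s
      / partialSum V N y s - (trunc (N + 1) (logOf V)).derivative.evalEval y s‖
        ≤ 2 * C * (y ^ (N + 1) * t ^ N) := fun s ⟨hs0, hst⟩ => by
    have hhalf := hlow y s hy hs0 (hys s ⟨hs0, hst⟩)
    have hS : 0 < partialSum V N y s := by linarith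
    have hres := hC y s hy hs0 ((hys s ⟨hs0, hst⟩).trans hδ1)
    have hmono : C * (y ^ (N + 1) * s ^ N) ≤ C * (y ^ (N + 1) * t ^ N) := by gcongr
    have hnonneg : 0 ≤ C * (y ^ (N + 1) * t ^ N) := by positivity
    rw [Real.norm_eq_abs, div_sub' hS.ne', abs_div, abs_of_pos hS, div_le_iff₀ hS]
    nlinarith
  have hmean := (convex_Icc 0 t).norm_image_sub_le_of_norm_hasDerivWithin_le hderiv hbound
    (Set.left_mem_Icc.2 ht) (Set.right_mem_Icc.2 ht)
  simp only [partialSum_zero_right, h1, PowerSeries.constantCoeff_logOf h1, Polynomial.eval_one,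
    Polynomial.eval_zero, Real.log_one, sub_zero, Real.norm_eq_abs, abs_of_nonneg ht] at hmean
  exact hmean.trans_eq (by ring)

end PartialSums

/-! ### The derivative of `f_N` -/

section Derivative

open Real

theorem hasDerivAt_partialSum_log (V : ℝ[X]⟦X⟧) (N : ℕ) {x : ℝ} (hx : x ≠ 0) :
    HasDerivAt (fun x => partialSum V N (log x) x⁻¹)
      (x⁻¹ * partialSum (eulerDeriv V) N (log x) x⁻¹) x := by
  simp only [partialSum, coeff_eulerDeriv]
  rw [Finset.mul_sum]
  refine HasDerivAt.fun_sum fun n _ => ?_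
  have heval := ((PowerSeries.coeff n V).hasDerivAt (log x)).comp x (hasDerivAt_log hx)
  refine (heval.mul ((hasDerivAt_inv hx).pow n)).congr_deriv ?_
  cases n with
  | zero => simp [mul_comm]
  | succ n =>
    simp only [Function.comp_apply, Nat.add_sub_cancel, Pi.pow_apply, Polynomial.eval_sub,
      Polynomial.eval_mul, Polynomial.eval_natCast]
    ring

theorem partialSum_formalV_add (N : ℕ) (y t : ℝ) :
    partialSum formalV N y t + (P N).eval y * t ^ (N + 1)
      = 1 + t * (y - partialSum formalV N y t - partialSum (eulerDeriv formalV) N y t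
        + partialSum (PowerSeries.logOf formalV) N y t) := by
  have hsucc : partialSum formalV N y t + (P N).eval y * t ^ (N + 1)
      = partialSum formalV (N + 1) y t := (Finset.sum_range_succ _ _).symm
  rw [hsucc]
  conv_lhs => rw [formalV_eq]
  rw [partialSum_one_add_X_mul, partialSum_add, partialSum_sub, partialSum_sub, partialSum_C,
    Polynomial.eval_X]

theorem fN_eq (N : ℕ) (u : ℝ) :
    fN N u = u * (log u * partialSum formalV N (log (log u)) (log u)⁻¹) := by
  have hconst : PowerSeries.coeff 0 formalV = 1 := by
    rw [PowerSeries.coeff_zero_eq_constantCoeff_apply, formalV_spec.2.1]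
  have hshift : ∑ n ∈ Finset.Icc 1 N, (P (n - 1)).eval (log (log u)) / log u ^ n
      = ∑ n ∈ Finset.range N, (P n).eval (log (log u)) / log u ^ (n + 1) := by
    rw [Finset.range_eq_Ico]
    exact (Finset.sum_Ico_add' (fun n => (P (n - 1)).eval (log (log u)) / log u ^ n) 0 N 1).symm
  rw [fN, hshift, partialSum, Finset.sum_range_succ', hconst]
  simp only [P, inv_pow, div_eq_mul_inv, pow_zero, Polynomial.eval_one, mul_one]
  ring

theorem hasDerivAt_fN (N : ℕ) {u : ℝ} (hu : 1 < u) :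
    HasDerivAt (fN N) (log u + log (log u)
      + partialSum (PowerSeries.logOf formalV) N (log (log u)) (log u)⁻¹
      - (P N).eval (log (log u)) * (log u)⁻¹ ^ N) u := by
  have hx : log u ≠ 0 := (log_pos hu).ne'
  have hu0 : u ≠ 0 := by linarith
  have hinner := (hasDerivAt_id (log u)).mul (hasDerivAt_partialSum_log formalV N hx)
  have h := (hasDerivAt_id u).mul (hinner.comp u (hasDerivAt_log hu0))
  rw [funext (fN_eq N)]
  refine h.congr_deriv ?_
  have hrec := partialSum_formalV_add N (log (log u)) (log u)⁻¹
  simp only [id, Function.comp_apply, Pi.mul_apply]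
  rw [pow_succ] at hrec
  field_simp at hrec ⊢
  linear_combination hrec

end Derivative

/-! ### The error of the approximation -/

section Error

open Real

theorem eventually_norm_le_mul_of_norm_deriv_le {E : Type*} [NormedAddCommGroup E]
    [NormedSpace ℝ E] {f : ℝ → E} {g : ℝ → ℝ} {c : ℝ}
    (hf : ∀ᶠ x in atTop, DifferentiableAt ℝ f x) (hg : ∀ᶠ x in atTop, DifferentiableAt ℝ g x)
    (hle : ∀ᶠ x in atTop, ‖deriv f x‖ ≤ deriv g x) (hg_top : Tendsto g atTop atTop) (hc : 1 < c) :
    ∀ᶠ x in atTop, ‖f x‖ ≤ c * g x := by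
  obtain ⟨a, ha⟩ := eventually_atTop.1 (hf.and (hg.and hle))
  have hbound : ∀ b, a ≤ b → ‖f b‖ ≤ g b + (‖f a‖ - g a) := fun b hab =>
    image_norm_le_of_norm_deriv_right_le_deriv_boundary' (f' := deriv f)
      (B := fun x => g x + (‖f a‖ - g a)) (B' := deriv g)
      (fun x hx => (ha x hx.1).1.continuousAt.continuousWithinAt)
      (fun x hx => (ha x hx.1).1.hasDerivAt.hasDerivWithinAt)
      (by simp)
      (fun x hx => ((ha x hx.1).2.1.continuousAt.add continuousAt_const).continuousWithinAt)
      (fun x hx => ((ha x hx.1).2.1.hasDerivAt.add_const _).hasDerivWithinAt)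
      (fun x hx => (ha x hx.1).2.2) (Set.right_mem_Icc.2 hab)
  filter_upwards [eventually_ge_atTop a, hg_top.eventually_ge_atTop ((‖f a‖ - g a) / (c - 1))]
    with x hx hgx
  rw [div_le_iff₀ (by linarith)] at hgx
  linarith [hbound x hx]

/-- The size `u (log log u)^N / (log u)^(N+1)` of the error terms. -/
def errTerm (N : ℕ) (u : ℝ) : ℝ := u * log (log u) ^ N / log u ^ (N + 1)

theorem hasDerivAt_errTerm (N : ℕ) {u : ℝ} (hu : 1 < u) :
    HasDerivAt (errTerm N) (log (log u) ^ N / log u ^ (N + 1)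
      + (N * log (log u) ^ (N - 1) - (N + 1) * log (log u) ^ N) / log u ^ (N + 2)) u := by
  have hu0 : u ≠ 0 := by linarith
  have hx : log u ≠ 0 := (log_pos hu).ne'
  have hnum := (hasDerivAt_id u).mul (((hasDerivAt_log hu0).log hx).pow N)
  refine (hnum.div ((hasDerivAt_log hu0).pow (N + 1)) (pow_ne_zero _ hx)).congr_deriv ?_
  simp only [id, Pi.mul_apply, Pi.pow_apply, Nat.add_sub_cancel, Nat.cast_add, Nat.cast_one]
  field_simp
  ring

theorem eventually_le_two_mul_deriv_errTerm (N : ℕ) :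
    ∀ᶠ u in atTop, log (log u) ^ N / log u ^ (N + 1) ≤ 2 * deriv (errTerm N) u := by
  filter_upwards [eventually_gt_atTop 1, tendsto_log_atTop.eventually_ge_atTop (2 * (N + 1 : ℝ)),
    (tendsto_log_atTop.comp tendsto_log_atTop).eventually_ge_atTop 0] with u hu hx hy
  rw [Function.comp_apply] at hy
  have hx0 : 0 < log u := log_pos hu
  have hle : (N + 1) * log (log u) ^ N / log u ^ (N + 2)
      ≤ 1 / 2 * (log (log u) ^ N / log u ^ (N + 1)) := by
    have hsmall : (N + 1 : ℝ) / log u ≤ 1 / 2 := by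
      rw [div_le_iff₀ hx0]
      linarith
    calc (N + 1) * log (log u) ^ N / log u ^ (N + 2)
        = (N + 1) / log u * (log (log u) ^ N / log u ^ (N + 1)) := by
          rw [div_mul_div_comm, ← pow_succ']
      _ ≤ _ := by gcongr
  have hnonneg : 0 ≤ N * log (log u) ^ (N - 1) / log u ^ (N + 2) := by positivity
  rw [(hasDerivAt_errTerm N hu).deriv, sub_div]
  linarith

theorem tendsto_errTerm (N : ℕ) : Tendsto (errTerm N) atTop atTop := by
  refine tendsto_atTop_mono' _ ?_ ((tendsto_exp_div_pow_atTop (N + 1)).comp tendsto_log_atTop)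
  filter_upwards [eventually_gt_atTop 1,
    (tendsto_log_atTop.comp tendsto_log_atTop).eventually_ge_atTop 1] with u hu hy
  have hx : 0 < log u := log_pos hu
  have hy' : 1 ≤ log (log u) ^ N := one_le_pow₀ hy
  rw [Function.comp_apply, exp_log (by linarith), errTerm]
  gcongr
  exact le_mul_of_one_le_right (by linarith) hy'

theorem tendsto_log_mul_inv : Tendsto (fun x : ℝ => log x * x⁻¹) atTop (𝓝 0) :=
  isLittleO_log_id_atTop.tendsto_div_nhds_zero

theorem eventually_half_le_partialSum (N : ℕ) :
    ∀ᶠ x : ℝ in atTop, 1 / 2 ≤ partialSum formalV N (log x) x⁻¹ := by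
  obtain ⟨_, δ, hδ, h⟩ :=
    exists_abs_log_partialSum_sub_le formalV_spec.1 formalV_spec.2.1 N
  filter_upwards [eventually_ge_atTop 0, tendsto_log_atTop.eventually_ge_atTop 1,
    tendsto_log_mul_inv.eventually_le_const hδ] with x hx hy hyt
  exact (h _ _ hy (inv_nonneg.2 hx) hyt).1

theorem log_fN {N : ℕ} {u : ℝ} (hu : 1 < u)
    (hS : 0 < partialSum formalV N (log (log u)) (log u)⁻¹) :
    log (fN N u) = log u + log (log u) + log (partialSum formalV N (log (log u)) (log u)⁻¹) := by
  have hx := log_pos hu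
  rw [fN_eq, log_mul (by positivity) (by positivity), log_mul hx.ne' hS.ne', add_assoc]

theorem tendsto_fN (N : ℕ) : Tendsto (fN N) atTop atTop := by
  refine tendsto_atTop_mono' _ ?_ (tendsto_id.atTop_mul_const (by norm_num : (0 : ℝ) < 1 / 2))
  filter_upwards [tendsto_log_atTop.eventually (eventually_half_le_partialSum N),
    tendsto_log_atTop.eventually_ge_atTop 1, eventually_ge_atTop 0] with u hS hx hu
  rw [fN_eq, id]
  gcongr
  nlinarith

theorem eventually_log_le_log_fN (N : ℕ) : ∀ᶠ u in atTop, log u ≤ log (fN N u) := by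
  filter_upwards [eventually_gt_atTop 1,
    tendsto_log_atTop.eventually (eventually_half_le_partialSum N),
    (tendsto_log_atTop.comp tendsto_log_atTop).eventually_ge_atTop 1] with u hu hS hy
  have hlogS : -1 ≤ log (partialSum formalV N (log (log u)) (log u)⁻¹) := by
    have h := log_le_log (by norm_num) hS
    rw [one_div, log_inv] at h
    linarith [log_two_lt_d9]
  rw [log_fN hu (by linarith)]
  rw [Function.comp_apply] at hy
  linarith

theorem hasDerivAt_li_fN_sub {N : ℕ} {u : ℝ} (hu : 1 < u) (hf : 1 < fN N u)
    (hS : 0 < partialSum formalV N (log (log u)) (log u)⁻¹) :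
    HasDerivAt (fun u => li (fN N u) - u)
      (-(log (partialSum formalV N (log (log u)) (log u)⁻¹)
          - partialSum (PowerSeries.logOf formalV) N (log (log u)) (log u)⁻¹
          + (P N).eval (log (log u)) * (log u)⁻¹ ^ N) / log (fN N u)) u := by
  refine (((hasDerivAt_li hf).comp u (hasDerivAt_fN N hu)).sub (hasDerivAt_id u)).congr_deriv ?_
  have hlog : log (fN N u) ≠ 0 := (log_pos hf).ne'
  rw [eq_div_iff hlog, sub_mul, mul_right_comm, inv_mul_cancel₀ hlog]
  linear_combination -(log_fN hu hS)

theorem eventually_abs_eval_P_le {N : ℕ} (hN : 1 ≤ N) :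
    ∀ᶠ y in atTop, |(P N).eval y| ≤ 3 / 2 * y ^ N := by
  have hlim : |(-1 : ℝ) ^ (N + 1) / N| < 3 / 2 := by
    have hN' : (1 : ℝ) ≤ N := by exact_mod_cast hN
    rw [abs_div, abs_pow, abs_neg, abs_one, one_pow, abs_of_nonneg (by positivity),
      div_lt_iff₀ (by positivity)]
    linarith
  filter_upwards [eventually_gt_atTop 0,
    (tendsto_eval_P_div_pow hN).abs.eventually_le_const hlim] with y hy h
  rwa [abs_div, abs_of_pos (pow_pos hy N), div_le_iff₀ (pow_pos hy N)] at h

theorem eventually_abs_log_partialSum_sub_add_le {N : ℕ} (hN : 1 ≤ N) :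
    ∀ᶠ x : ℝ in atTop, |log (partialSum formalV N (log x) x⁻¹)
      - partialSum (PowerSeries.logOf formalV) N (log x) x⁻¹ + (P N).eval (log x) * x⁻¹ ^ N|
        ≤ 2 * (log x * x⁻¹) ^ N := by
  obtain ⟨C, δ, hδ, h⟩ := exists_abs_log_partialSum_sub_le formalV_spec.1 formalV_spec.2.1 N
  have hC : Tendsto (fun x : ℝ => C * (log x * x⁻¹)) atTop (𝓝 0) := by
    simpa only [mul_zero] using tendsto_log_mul_inv.const_mul C
  filter_upwards [eventually_gt_atTop 0, tendsto_log_atTop.eventually_ge_atTop 1,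
    tendsto_log_mul_inv.eventually_le_const hδ, hC.eventually_le_const one_half_pos,
    tendsto_log_atTop.eventually (eventually_abs_eval_P_le hN)] with x hx hy hyt hCyt hP
  have hlog := (h _ _ hy (inv_nonneg.2 hx.le) hyt).2
  have hres : C * (log x * x⁻¹) ^ (N + 1) ≤ 1 / 2 * (log x * x⁻¹) ^ N := by
    rw [pow_succ', ← mul_assoc]
    gcongr
  have htop : |(P N).eval (log x) * x⁻¹ ^ N| ≤ 3 / 2 * (log x * x⁻¹) ^ N := by
    rw [abs_mul, abs_of_nonneg (by positivity : 0 ≤ x⁻¹ ^ N), mul_pow, ← mul_assoc]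
    gcongr
  exact (abs_add_le _ _).trans (by linarith)

theorem eventually_differentiableAt_li_fN_sub (N : ℕ) :
    ∀ᶠ u in atTop, DifferentiableAt ℝ (fun u => li (fN N u) - u) u := by
  filter_upwards [eventually_gt_atTop 1, (tendsto_fN N).eventually_gt_atTop 1,
    tendsto_log_atTop.eventually (eventually_half_le_partialSum N)] with u hu hf hS
  exact (hasDerivAt_li_fN_sub hu hf (by linarith)).differentiableAt

theorem eventually_abs_deriv_li_fN_sub_le {N : ℕ} (hN : 1 ≤ N) :
    ∀ᶠ u in atTop, |deriv (fun u => li (fN N u) - u) u|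
      ≤ 2 * (log (log u) ^ N / log u ^ (N + 1)) := by
  filter_upwards [eventually_gt_atTop 1, (tendsto_fN N).eventually_gt_atTop 1,
    tendsto_log_atTop.eventually (eventually_half_le_partialSum N),
    tendsto_log_atTop.eventually (eventually_abs_log_partialSum_sub_add_le hN),
    eventually_log_le_log_fN N] with u hu hf hS hnum hden
  have hx := log_pos hu
  rw [(hasDerivAt_li_fN_sub hu hf (by linarith)).deriv, abs_div, abs_neg,
    abs_of_pos (hx.trans_le hden)]
  calc _ ≤ 2 * (log (log u) * (log u)⁻¹) ^ N / log u :=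
        div_le_div₀ ((abs_nonneg _).trans hnum) hnum hx hden
    _ = 2 * (log (log u) ^ N / log u ^ (N + 1)) := by
        rw [← div_eq_mul_inv, div_pow, pow_succ, ← div_div, mul_div_assoc]

theorem eventually_abs_li_fN_sub_le {N : ℕ} (hN : 1 ≤ N) :
    ∀ᶠ u in atTop, |li (fN N u) - u| ≤ 13 * errTerm N u := by
  have hdiff : ∀ᶠ u in atTop, DifferentiableAt ℝ (errTerm N) u :=
    (eventually_gt_atTop 1).mono fun u hu => (hasDerivAt_errTerm N hu).differentiableAt
  have hderiv : ∀ᶠ u in atTop,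
      ‖deriv (fun u => li (fN N u) - u) u‖ ≤ deriv (fun u => 4 * errTerm N u) u := by
    filter_upwards [eventually_abs_deriv_li_fN_sub_le hN, eventually_le_two_mul_deriv_errTerm N,
      hdiff] with u hF hE hd
    rw [deriv_const_mul _ hd, norm_eq_abs]
    linarith
  have h := eventually_norm_le_mul_of_norm_deriv_le (eventually_differentiableAt_li_fN_sub N)
    (hdiff.mono fun u hu => hu.const_mul 4) hderiv
    ((tendsto_errTerm N).const_mul_atTop four_pos) (by norm_num : (1 : ℝ) < 13 / 4)
  filter_upwards [h] with u hu
  rw [norm_eq_abs] at hu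
  linarith

end Error

/-! ### Estimates beyond `u_N` -/

section Thresholds

open Real

theorem strictMonoOn_div_log : StrictMonoOn (fun x => x / log x) (Set.Ici (exp 1)) := by
  intro a ha b hb hab
  have ha0 : 0 < a := (exp_pos 1).trans_le ha
  have hlog : ∀ {x}, x ∈ Set.Ici (exp 1) → 1 ≤ log x := fun hx =>
    (le_log_iff_exp_le ((exp_pos 1).trans_le hx)).2 hx
  have hratio : log b - log a < b / a - 1 := by
    rw [← log_div (ha0.trans hab).ne' ha0.ne']
    exact log_lt_sub_one_of_pos (div_pos (ha0.trans hab) ha0) ((one_lt_div ha0).2 hab).ne'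
  rw [lt_sub_iff_add_lt, lt_div_iff₀ ha0] at hratio
  change a / log a < b / log b
  rw [div_lt_div_iff₀ (by linarith [hlog ha]) (by linarith [hlog hb])]
  nlinarith [mul_nonneg (sub_nonneg.2 hab.le) (sub_nonneg.2 (hlog ha))]

theorem tendsto_div_log : Tendsto (fun x : ℝ => x / log x) atTop atTop := by
  have hlim : Tendsto (fun x : ℝ => log x * x⁻¹) atTop (𝓝[>] 0) :=
    tendsto_nhdsWithin_iff.2 ⟨tendsto_log_mul_inv, by
      filter_upwards [eventually_gt_atTop 1] with x hx
      exact mul_pos (log_pos hx) (by positivity)⟩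
  exact hlim.inv_tendsto_nhdsGT_zero.congr fun x => by simp [div_eq_mul_inv]

theorem exists_div_log_eq {c : ℝ} (hc : exp 1 ≤ c) : ∃ x, exp 1 ≤ x ∧ x / log x = c := by
  have hcont : ContinuousOn (fun x : ℝ => x / log x) (Set.Ici (exp 1)) := by
    refine continuousOn_id.div (continuousOn_log.mono fun x hx => ?_) fun x hx => ?_
    · exact ((exp_pos 1).trans_le hx).ne'
    · exact (log_pos ((one_lt_exp_iff.2 one_pos).trans_le hx)).ne'
  exact intermediate_value_Ici hcont tendsto_div_log (by simpa using hc)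

theorem alphaN_lt_div_log {N : ℕ} {x : ℝ} (hx : betaN N < x) : alphaN N < x / log x := by
  obtain ⟨b, ⟨hb, hbα⟩, hbx⟩ := exists_lt_of_csInf_lt (exists_div_log_eq (le_max_left _ _)) hx
  rw [alphaN, ← hbα]
  exact strictMonoOn_div_log hb (hb.trans hbx.le) hbx

theorem tendsto_sum_factorial_div_pow (N : ℕ) :
    Tendsto (fun x : ℝ => ∑ n ∈ Finset.Icc 1 N, (n ! : ℝ) / x ^ n) atTop (𝓝 0) := by
  rw [← Finset.sum_const_zero (s := Finset.Icc 1 N)]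
  refine tendsto_finsetSum _ fun n hn => tendsto_const_nhds.div_atTop (tendsto_pow_atTop ?_)
  exact Nat.one_le_iff_ne_zero.1 (Finset.mem_Icc.1 hn).1

theorem exists_one_le_mul_one_sub_sum (N : ℕ) :
    ∃ c : ℝ, 0 < c ∧ ∀ x : ℝ, c ≤ x → 1 ≤ x * (1 - ∑ n ∈ Finset.Icc 1 N, (n ! : ℝ) / x ^ n) := by
  obtain ⟨a, ha⟩ := eventually_atTop.1
    ((tendsto_sum_factorial_div_pow N).eventually_le_const one_half_pos)
  refine ⟨max a 2, by positivity, fun x hx => ?_⟩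
  have hsum := ha x ((le_max_left _ _).trans hx)
  have hx2 : 2 ≤ x := (le_max_right _ _).trans hx
  nlinarith

theorem factorial_le_pow {N : ℕ} (hN : 1 ≤ N) {w : ℝ} (hw0 : 0 < w) (hw : cN N < w) :
    (N ! : ℝ) ≤ w ^ N := by
  obtain ⟨c, ⟨-, hc⟩, hcw⟩ := exists_lt_of_csInf_lt (exists_one_le_mul_one_sub_sum N) hw
  have hterm : (N ! : ℝ) / w ^ N ≤ ∑ n ∈ Finset.Icc 1 N, (n ! : ℝ) / w ^ n :=
    Finset.single_le_sum (f := fun n => (n ! : ℝ) / w ^ n) (fun n _ => by positivity)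
      (Finset.mem_Icc.2 ⟨hN, le_rfl⟩)
  have hpos := pos_of_mul_pos_right (one_pos.trans_le (hc w hcw.le)) hw0.le
  exact (div_le_one (by positivity)).1 (by linarith)

theorem xN_le_log {N : ℕ} {u : ℝ} (hu : uN N ≤ u) : xN N ≤ log u :=
  (le_log_iff_exp_le ((exp_pos _).trans_le hu)).2 hu

theorem seven_lt_log {N : ℕ} {u : ℝ} (hu : uN N ≤ u) : 7 < log u := by
  have hexp : exp 2 ≤ log u := ((le_max_right _ _).trans (le_max_right _ _)).trans (xN_le_log hu)
  have hsq : exp 2 = exp 1 * exp 1 := by rw [← exp_add]; norm_num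
  nlinarith [exp_one_gt_d9]

theorem one_lt_of_uN_le {N : ℕ} {u : ℝ} (hu : uN N ≤ u) : 1 < u :=
  (log_pos_iff ((exp_pos _).trans_le hu).le).1 (by linarith [seven_lt_log hu])

theorem errTerm_nonneg {N : ℕ} {u : ℝ} (hu : uN N ≤ u) : 0 ≤ errTerm N u := by
  have hx := seven_lt_log hu
  have hu0 := one_lt_of_uN_le hu
  have hy : 0 < log (log u) := log_pos (by linarith)
  rw [errTerm]
  positivity

theorem factorial_mul_errTerm_le {N : ℕ} (hN : 1 ≤ N) {u : ℝ} (hu : uN N < u) :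
    13 * ((N + 1)! : ℝ) * errTerm N u ≤ 10 * u := by
  have hu1 := one_lt_of_uN_le hu.le
  have hx := seven_lt_log hu.le
  have hx0 : 0 < log u := by linarith
  have hy0 : 0 < log (log u) := log_pos (by linarith)
  have hxN : xN N < log u := (lt_log_iff_exp_lt (by linarith)).2 hu
  have hfac : (N ! : ℝ) * log (log u) ^ N / log u ^ N ≤ 1 := by
    have hα := alphaN_lt_div_log ((le_max_left _ _).trans_lt hxN)
    have h := factorial_le_pow hN (by positivity)
      (((le_max_left _ _).trans (le_max_right _ _)).trans_lt hα)
    rw [div_pow, le_div_iff₀ (by positivity)] at h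
    exact (div_le_one (by positivity)).2 h
  have hratio : (N + 1 : ℝ) / log u ≤ 3 / 4 := by
    have h : 4 * (N + 1 : ℝ) / 3 ≤ log u :=
      ((le_max_left _ _).trans (le_max_right _ _)).trans hxN.le
    rw [div_le_iff₀ hx0]
    linarith
  calc 13 * ((N + 1)! : ℝ) * errTerm N u
      = 13 * u * ((N + 1) / log u) * ((N ! : ℝ) * log (log u) ^ N / log u ^ N) := by
        rw [errTerm, Nat.factorial_succ, pow_succ (log u)]
        push_cast
        field_simp
    _ ≤ 13 * u * (3 / 4) * 1 := by gcongr
    _ ≤ 10 * u := by linarith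

theorem abs_le_iff_exists_mul {a b : ℝ} (hb : 0 ≤ b) : |a| ≤ b ↔ ∃ θ, |θ| ≤ 1 ∧ a = θ * b := by
  constructor
  · intro h
    rcases hb.eq_or_lt with rfl | hb
    · exact ⟨0, by simp, by simpa using h⟩
    · refine ⟨a / b, ?_, (div_mul_cancel₀ a hb.ne').symm⟩
      rwa [abs_div, abs_of_pos hb, div_le_one hb]
  · rintro ⟨θ, hθ, rfl⟩
    rw [abs_mul, abs_of_nonneg hb]
    exact mul_le_of_le_one_left hb hθ

theorem isThreshold_iff {N : ℕ} {v : ℝ} : IsThreshold N v ↔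
    uN N ≤ v ∧ ∀ u, v < u → |li (fN N u) - u| ≤ 13 * ((N + 1)! : ℝ) * errTerm N u := by
  refine and_congr_right fun hv => forall₂_congr fun u hu => ?_
  have hE := errTerm_nonneg (hv.trans hu.le)
  rw [abs_le_iff_exists_mul (by positivity)]
  simp only [errTerm, mul_assoc]

theorem exists_isThreshold {N : ℕ} (hN : 1 ≤ N) : ∃ v, uN N < v ∧ IsThreshold N v := by
  obtain ⟨a, ha⟩ := eventually_atTop.1 (eventually_abs_li_fN_sub_le hN)
  have hv : uN N < max a (uN N + 1) := lt_max_of_lt_right (lt_add_one _)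
  refine ⟨_, hv, isThreshold_iff.2 ⟨hv.le, fun u hu => ?_⟩⟩
  have hE := errTerm_nonneg (hv.trans hu).le
  have hfac : (1 : ℝ) ≤ (N + 1)! := by exact_mod_cast Nat.factorial_pos _
  calc |li (fN N u) - u| ≤ 13 * 1 * errTerm N u := by
        simpa using ha u ((le_max_left _ _).trans hu.le)
    _ ≤ 13 * ((N + 1)! : ℝ) * errTerm N u := by gcongr

theorem isThreshold_vN {N : ℕ} (hN : 1 ≤ N) : IsThreshold N (vN N) := by
  obtain ⟨v₀, -, hv₀⟩ := exists_isThreshold hN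
  have hne : {v : ℝ | IsThreshold N v}.Nonempty := ⟨v₀, hv₀⟩
  refine ⟨le_csInf hne fun v hv => hv.1, fun u hu => ?_⟩
  obtain ⟨v, hv, hvu⟩ := exists_lt_of_csInf_lt hne hu
  exact hv.2 u hvu

end Thresholds

section Inversion

open Real

namespace IsThreshold

variable {N : ℕ} {u v : ℝ}

theorem abs_li_fN_sub_le (hv : IsThreshold N v) (hN : 1 ≤ N) (hu : v < u) :
    |li (fN N u) - u| ≤ 10 * u :=
  ((isThreshold_iff.1 hv).2 u hu).trans (factorial_mul_errTerm_le hN (hv.1.trans_lt hu))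

-- If `f_N` dropped to `1`, it would also take values just above `1`, where `li` is close to `-∞`.
theorem one_lt_fN (hv : IsThreshold N v) (hN : 1 ≤ N) (hu : v < u) : 1 < fN N u := by
  by_contra! hfu
  have hu1 : 1 < u := one_lt_of_uN_le (hv.1.trans hu.le)
  obtain ⟨U, hU, huU⟩ :=
    (((tendsto_fN N).eventually_ge_atTop (ali 0)).and (eventually_ge_atTop u)).exists
  have hw : ali (-(9 * U) - 1) ∈ Set.Icc (fN N u) (fN N U) :=
    ⟨hfu.trans (one_lt_ali _).le, (strictMono_ali (by linarith)).le.trans hU⟩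
  obtain ⟨z, ⟨huz, hzU⟩, hz⟩ := intermediate_value_Icc huU
    (fun z hz => (hasDerivAt_fN N (hu1.trans_le hz.1)).continuousAt.continuousWithinAt) hw
  have hli := (abs_le.1 (hv.abs_li_fN_sub_le hN (hu.trans_le huz))).1
  rw [hz, li_ali] at hli
  linarith

theorem abs_ali_sub_fN_le (hv : IsThreshold N v) (hN : 1 ≤ N) (hu : v < u) :
    |ali u - fN N u| ≤ 26 * ((N + 1)! : ℝ) * u * (log (log u) / log u) ^ N := by
  have hu1 : 1 < u := one_lt_of_uN_le (hv.1.trans hu.le)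
  have hx : 7 < log u := seven_lt_log (hv.1.trans hu.le)
  have hli : li (fN N u) ≤ 11 * u := by
    linarith [(abs_le.1 (hv.abs_li_fN_sub_le hN hu)).2]
  have hlog : log (ali (11 * u)) ≤ 2 * log u := by
    have h := log_le_log (one_pos.trans (one_lt_ali _)) (ali_eleven_mul_le_sq (by linarith) hx.le)
    rwa [log_pow] at h
  calc |ali u - fN N u| = |ali u - ali (li (fN N u))| := by rw [ali_li (hv.one_lt_fN hN hu)]
    _ ≤ log (ali (11 * u)) * |u - li (fN N u)| := abs_ali_sub_ali_le hli (by linarith)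
    _ ≤ 2 * log u * (13 * ((N + 1)! : ℝ) * errTerm N u) := by
        rw [abs_sub_comm u]
        gcongr
        exact (isThreshold_iff.1 hv).2 u hu
    _ = 26 * ((N + 1)! : ℝ) * u * (log (log u) / log u) ^ N := by
        rw [errTerm, div_pow, pow_succ (log u)]
        field_simp
        ring

theorem abs_ali_sub_fN_le_of_le (hv : IsThreshold N v) (hN : 1 ≤ N) (hu : v ≤ u) :
    |ali u - fN N u| ≤ 26 * ((N + 1)! : ℝ) * u * (log (log u) / log u) ^ N := by
  have hu1 : 1 < u := one_lt_of_uN_le (hv.1.trans hu)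
  have hx : 7 < log u := seven_lt_log (hv.1.trans hu)
  have hloglog : ContinuousAt (fun u => log (log u) / log u) u :=
    ((continuousAt_log (by linarith)).log (by linarith)).div (continuousAt_log (by linarith))
      (by linarith)
  refine ContinuousWithinAt.closure_le (s := Set.Ioi u) (by simp)
    (continuous_ali.continuousAt.sub (hasDerivAt_fN N hu1).continuousAt).abs.continuousWithinAt
    ((continuousAt_const.mul continuousAt_id).mul (hloglog.pow N)).continuousWithinAt
    fun z hz => hv.abs_ali_sub_fN_le hN (hu.trans_lt hz)

end IsThreshold

end Inversion

end AliExpansion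

end

theorem mainTheorem2 (N : ℕ) (hN : 1 ≤ N) :
    (∃ v : ℝ, AliExpansion.uN N < v ∧ AliExpansion.IsThreshold N v) ∧
    ∀ u : ℝ, AliExpansion.vN N ≤ u → ∃ θ : ℝ, |θ| ≤ 1 ∧
      AliExpansion.ali u = AliExpansion.fN N u
        + 26 * θ * ((N + 1)! : ℝ) * u * (Real.log (Real.log u) / Real.log u) ^ N := by
  refine ⟨AliExpansion.exists_isThreshold hN, fun u hu => ?_⟩
  have hbound := (AliExpansion.isThreshold_vN hN).abs_ali_sub_fN_le_of_le hN hu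
  obtain ⟨θ, hθ, h⟩ :=
    (AliExpansion.abs_le_iff_exists_mul ((abs_nonneg _).trans hbound)).1 hbound
  exact ⟨θ, hθ, by linear_combination h⟩
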